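/- For a group $L$ and $x,y\in L$ write $x^y=y^{-1}xy$ and $[x,y]=x^{-1}y^{-1}xy$; for subgroups $H,K\le L$ let $[H,K]$ be the subgroup generated by all $[h,k]$ with $h\in H$, $k\in K$, and put $[H,{}_0K]=H$, $[H,{}_{n}K]=[[H,{}_{n-1}K],K]$ for $n\ge 1$. Let $L^{(0)}=L$, $L^{(k+1)}=[L^{(k)},L^{(k)}]$ be the derived series and $\gamma_1(L)=L$, $\gamma_{r+1}(L)=[\gamma_r(L),L]$ the lower central series. The exponent $\exp(L)$ is the least positive integer $n$ with $x^n=1$ for all $x\in L$ (and $0$ if there is no such $n$). For a group $G$, let $G^{\varphi}=\{g^{\varphi}\mid g\in G\}$ be an isomorphic copy of $G$ via $\varphi : g\mapsto g^{\varphi}$, and let $$\nu(G)=\langle G\cup G^{\varphi}\mid [g_1,g_2^{\varphi}]^{g_3}=[g_1^{g_3},(g_2^{g_3})^{\varphi}]=[g_1,g_2^{\varphi}]^{g_3^{\varphi}}\ \text{for all } g_1,g_2,g_3\in G\rangle$$ (the quotient of the free product $G * G^{\varphi}$ by these relations). In $\nu(G)$ put $\Upsilon_1(G)=[G,G^{\varphi}]$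 and, for $k\ge 1$, $A_k(G)=[\Upsilon_1(G),{}_{k-1}G]$. Let $p$ be a prime and let $G$ be a finite $p$-group. Then: (a) for every $k\ge 0$, $\exp(\nu(G)^{(k+1)})=\exp(\Upsilon_1(G)^{(k)})$; (b) for every $r\ge 2$, $\exp(\gamma_r(\nu(G)))=\exp(A_{r-1}(G))$. -/

import Mathlib

namespace NuGroup

/-- The conjugate `x ^ y = y⁻¹ x y`. -/
def conjBy {H : Type*} [Group H] (x y : H) : H := y⁻¹ * x * y

/-- The commutator `[x, y] = x⁻¹ y⁻¹ x y`. -/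
def comm {H : Type*} [Group H] (x y : H) : H := x⁻¹ * y⁻¹ * x * y

/-- The first copy `G → G ∗ G`, written `g`. -/
def freeLeft (G : Type*) [Group G] : G →* Monoid.Coprod G G := Monoid.Coprod.inl

/-- The second copy `G → G ∗ G`, written `g ^ φ`. -/
def freeRight (G : Type*) [Group G] : G →* Monoid.Coprod G G := Monoid.Coprod.inr

/-- The defining relators of `ν(G)` in the free product `G ∗ G^φ`, expressing
`[a, b^φ] ^ c = [a ^ c, (b ^ c)^φ]` and `[a, b^φ] ^ (c^φ) = [a ^ c, (b ^ c)^φ]`. -/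
def relators (G : Type*) [Group G] : Set (Monoid.Coprod G G) :=
  {w | ∃ a b c : G,
    w = conjBy (comm (freeLeft G a) (freeRight G b)) (freeLeft G c) *
        (comm (freeLeft G (conjBy a c)) (freeRight G (conjBy b c)))⁻¹ ∨
    w = conjBy (comm (freeLeft G a) (freeRight G b)) (freeRight G c) *
        (comm (freeLeft G (conjBy a c)) (freeRight G (conjBy b c)))⁻¹}

/-- The group `ν(G) = ⟨G ∪ G^φ ∣ [a, b^φ] ^ c = [a ^ c, (b ^ c)^φ] = [a, b^φ] ^ (c^φ)⟩`. -/
def Nu (G : Type*) [Group G] : Type _ :=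
  Monoid.Coprod G G ⧸ Subgroup.normalClosure (relators G)

instance (G : Type*) [Group G] : Group (Nu G) :=
  inferInstanceAs (Group (Monoid.Coprod G G ⧸ Subgroup.normalClosure (relators G)))

/-- The canonical homomorphism `G → ν(G)`, `g ↦ g`. -/
def left (G : Type*) [Group G] : G →* Nu G :=
  (QuotientGroup.mk' (Subgroup.normalClosure (relators G))).comp (freeLeft G)

/-- The canonical homomorphism `G → ν(G)`, `g ↦ g^φ`. -/
def right (G : Type*) [Group G] : G →* Nu G :=
  (QuotientGroup.mk' (Subgroup.normalClosure (relators G))).comp (freeRight G)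

/-- The subgroup `Υ₁(G) = [G, G^φ]` of `ν(G)`. -/
def Upsilon₁ (G : Type*) [Group G] : Subgroup (Nu G) := ⁅(left G).range, (right G).range⁆

/-- `[H, ₙK]`: `[H, ₀K] = H` and `[H, ₙ₊₁K] = [[H, ₙK], K]`. -/
def iterComm {L : Type*} [Group L] (H K : Subgroup L) : ℕ → Subgroup L
  | 0 => H
  | n + 1 => ⁅iterComm H K n, K⁆

/-- `A_k(G) = [Υ₁(G), ₖ₋₁G]` for `k ≥ 1`; only these values of `k` are meaningful. -/
def A (G : Type*) [Group G] (k : ℕ) : Subgroup (Nu G) :=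
  iterComm (Upsilon₁ G) (left G).range (k - 1)

/-- `γ_r(L)` for `r ≥ 1`, with `γ_1(L) = L`; only these values of `r` are meaningful. -/
def gamma (L : Type*) [Group L] (r : ℕ) : Subgroup L :=
  (⊤ : Subgroup L).lowerCentralSeries (r - 1)

end NuGroup

/-! Write Υ = [G, G^φ] and let ρ : ν(G) → G identify the two copies. The relations make g and g^φ
act alike on Υ, so ν(G) acts on Υ through ρ and ker ρ centralizes Υ. Hence t ↦ t⁻¹ρ(t) and t ↦
t⁻¹ρ(t)^φ are homomorphisms on Υ whose images centralize Υ. The first image also centralizes G^φ and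
the second centralizes G, so the two commute with each other, and (a, b, c) ↦ a · a twist of b · a
twist of c is a homomorphism from Υ³ (`tripleHom`).

Its image contains ν(G)' (`commutator_le_triple`). Inductively, ν(G)^(k+1) lies in the image of the
cube of Υ^(k), and γ_r in that of the cube of A_{r-1}, so their exponents divide those of Υ^(k) and
A_{r-1}. Conversely Υ^(k) ≤ ν(G)^(k+1) and A_{r-1} ≤ γ_r. -/

theorem Subgroup.commutator_sup_le_of_normal {L : Type*} [Group L] (H A B N : Subgroup L)
    [N.Normal] (hA : ⁅H, A⁆ ≤ N) (hB : ⁅H, B⁆ ≤ N) : ⁅H, A ⊔ B⁆ ≤ N := by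
  -- Modulo N the condition says that C centralizes H, and a centralizer is closed under joins.
  have key (C : Subgroup L) : ⁅H, C⁆ ≤ N ↔
      C.map (QuotientGroup.mk' N) ≤ centralizer (H.map (QuotientGroup.mk' N)) := by
    rw [← commutator_eq_bot_iff_le_centralizer, commutator_comm, ← map_commutator,
      map_eq_bot_iff, QuotientGroup.ker_mk']
  rw [key] at *
  rw [map_sup]
  exact sup_le hA hB

/-! ### The action on [G, G^φ] -/

open scoped commutatorElement

namespace NuGroup

/-- A pair of homomorphisms `l r : G →* L`, jointly generating `L` and with a common retraction
`ρ`, that satisfies the defining relations of `ν(G)`. -/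
structure IsNuPair {G L : Type*} [Group G] [Group L] (l r : G →* L) (ρ : L →* G) : Prop where
  retract_left : ∀ g, ρ (l g) = g
  retract_right : ∀ g, ρ (r g) = g
  range_sup_range : l.range ⊔ r.range = ⊤
  conj_left : ∀ a b c, l c * ⁅l a, r b⁆ * (l c)⁻¹ = ⁅l (c * a * c⁻¹), r (c * b * c⁻¹)⁆
  conj_right : ∀ a b c, r c * ⁅l a, r b⁆ * (r c)⁻¹ = ⁅l (c * a * c⁻¹), r (c * b * c⁻¹)⁆

namespace IsNuPair

variable {G L : Type*} [Group G] [Group L] {l r : G →* L} {ρ : L →* G}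

/-- This symmetry transfers every fact about `twist` to `twist'`. -/
theorem symm (h : IsNuPair l r ρ) : IsNuPair r l ρ where
  retract_left := h.retract_right
  retract_right := h.retract_left
  range_sup_range := by rw [sup_comm, h.range_sup_range]
  conj_left a b c := by
    rw [← commutatorElement_inv, ← conj_inv, h.conj_right, commutatorElement_inv]
  conj_right a b c := by
    rw [← commutatorElement_inv, ← conj_inv, h.conj_left, commutatorElement_inv]

/-- To prove a property of all elements it suffices to treat products with generators. -/
theorem induction (h : IsNuPair l r ρ) {P : L → Prop} (one : P 1)
    (left : ∀ g x, P x → P (l g * x)) (right : ∀ g x, P x → P (r g * x)) (x : L) : P x := by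
  have hx : x ∈ Subgroup.closure ((l.range : Set L) ∪ r.range) := by
    rw [← Subgroup.sup_eq_closure, h.range_sup_range]; trivial
  induction hx using Subgroup.closure_induction_left with
  | one => exact one
  | mul_left y hy x _ ih =>
    rcases hy with ⟨g, rfl⟩ | ⟨g, rfl⟩
    exacts [left g x ih, right g x ih]
  | inv_mul_cancel y hy x _ ih =>
    rcases hy with ⟨g, rfl⟩ | ⟨g, rfl⟩
    · rw [← map_inv]; exact left _ x ih
    · rw [← map_inv]; exact right _ x ih

theorem commutator_normal (h : IsNuPair l r ρ) : ⁅l.range, r.range⁆.Normal := by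
  rw [← Subgroup.normalizer_eq_top_iff, eq_top_iff, ← h.range_sup_range]
  exact sup_le (Subgroup.normalizer_commutator_ge_left _ _)
    (Subgroup.normalizer_commutator_ge_right _ _)

theorem conj_left_eq_conj_right (h : IsNuPair l r ρ) (c : G) {s : L}
    (hs : s ∈ ⁅l.range, r.range⁆) : l c * s * (l c)⁻¹ = r c * s * (r c)⁻¹ := by
  have : ⁅l.range, r.range⁆ ≤
      (MulAut.conj (l c)).toMonoidHom.eqLocus (MulAut.conj (r c)).toMonoidHom := by
    rw [Subgroup.commutator_le]
    rintro _ ⟨a, rfl⟩ _ ⟨b, rfl⟩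
    exact (h.conj_left a b c).trans (h.conj_right a b c).symm
  exact this hs

theorem conj_eq_conj_retract (h : IsNuPair l r ρ) (x : L) {s : L}
    (hs : s ∈ ⁅l.range, r.range⁆) : x * s * x⁻¹ = l (ρ x) * s * (l (ρ x))⁻¹ := by
  have := h.commutator_normal
  induction x using h.induction with
  | one => simp
  | left g x ih =>
    rw [mul_inv_rev, show l g * x * s * (x⁻¹ * (l g)⁻¹) = l g * (x * s * x⁻¹) * (l g)⁻¹ by group,
      ih, map_mul, h.retract_left, map_mul]
    group
  | right g x ih =>
    rw [mul_inv_rev, show r g * x * s * (x⁻¹ * (r g)⁻¹) = r g * (x * s * x⁻¹) * (r g)⁻¹ by group,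
      ← h.conj_left_eq_conj_right g (this.conj_mem s hs x), ih, map_mul, h.retract_right, map_mul]
    group

theorem commute_of_retract_eq_one (h : IsNuPair l r ρ) {x s : L} (hx : ρ x = 1)
    (hs : s ∈ ⁅l.range, r.range⁆) : Commute x s := by
  have := h.conj_eq_conj_retract x hs
  rw [hx] at this
  simpa [mul_inv_eq_iff_eq_mul, commute_iff_eq] using this

/-! ### Twisted copies of [G, G^φ] -/

/-- The homomorphism `t ↦ t⁻¹ ρ(t)` from `[l(G), r(G)]` to `L`. -/
def twist (h : IsNuPair l r ρ) : ↥⁅l.range, r.range⁆ →* L where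
  toFun t := (t : L)⁻¹ * l (ρ t)
  map_one' := by simp
  map_mul' t s := by
    -- The element t⁻¹ρ(t) lies in ker ρ, so it can be moved past s⁻¹; this restores the order that
    -- inversion reverses.
    have h1 : Commute ((t : L)⁻¹ * l (ρ t)) (s : L)⁻¹ :=
      h.commute_of_retract_eq_one (by simp [h.retract_left]) (inv_mem s.2)
    simp only [Subgroup.coe_mul, map_mul, mul_inv_rev]
    rw [← mul_assoc _ (s : L)⁻¹, h1.eq]
    group

theorem twist_apply (h : IsNuPair l r ρ) (t : ↥⁅l.range, r.range⁆) :
    h.twist t = (t : L)⁻¹ * l (ρ t) := rfl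

theorem twist_commute_of_mem (h : IsNuPair l r ρ) (t : ↥⁅l.range, r.range⁆) {s : L}
    (hs : s ∈ ⁅l.range, r.range⁆) : Commute (h.twist t) s :=
  h.commute_of_retract_eq_one (by simp [twist_apply, h.retract_left]) hs

/-- For t = [a, b^φ] the claim is that t and its retraction [a, b] in the first copy conjugate c^φ
identically. As `twist` is a homomorphism, these generators suffice. -/
theorem twist_commute_right (h : IsNuPair l r ρ) (t : ↥⁅l.range, r.range⁆) (c : G) :
    Commute (h.twist t) (r c) := by
  obtain ⟨t, ht⟩ := t
  have key : ⁅l.range, r.range⁆ ≤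
      ((Subgroup.centralizer {r c}).comap h.twist).map (Subgroup.subtype _) := by
    rw [Subgroup.commutator_le]
    rintro _ ⟨a, rfl⟩ _ ⟨b, rfl⟩
    refine ⟨⟨_, Subgroup.commutator_mem_commutator ⟨a, rfl⟩ ⟨b, rfl⟩⟩, ?_, rfl⟩
    simp only [Subgroup.coe_comap, Set.mem_preimage, SetLike.mem_coe,
      Subgroup.mem_centralizer_singleton_iff, twist_apply, map_commutatorElement, h.retract_left,
      h.retract_right]
    -- Conjugation by b^φ turns the second entry b⁻¹cb into c, so the relation compares two
    -- conjugates of c^φ.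
    have h1 := h.conj_right a⁻¹ (b⁻¹ * c * b) b
    rw [show b * (b⁻¹ * c * b) * b⁻¹ = c by group] at h1
    simp only [commutatorElement_def, map_mul, map_inv] at h1 ⊢
    have h2 : l b * (l a)⁻¹ * (l b)⁻¹ * r c * (l b * (l a)⁻¹ * (l b)⁻¹)⁻¹ =
        (r b * (l a)⁻¹ * (r b)⁻¹) * r c * (r b * (l a)⁻¹ * (r b)⁻¹)⁻¹ := by
      rw [← mul_left_inj (r c)⁻¹, ← h1]
      group
    have h3 : l a * l b * (l a)⁻¹ * (l b)⁻¹ * r c * (l a * l b * (l a)⁻¹ * (l b)⁻¹)⁻¹ =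
        l a * (l b * (l a)⁻¹ * (l b)⁻¹ * r c * (l b * (l a)⁻¹ * (l b)⁻¹)⁻¹) * (l a)⁻¹ := by
      group
    rw [h2, mul_inv_eq_iff_eq_mul] at h3
    rw [mul_assoc, h3]
    group
  obtain ⟨s, hs, rfl⟩ := key ht
  exact (Subgroup.mem_centralizer_singleton_iff.1 hs)

/-- Conjugation by an element of `L` on the normal subgroup `[l(G), r(G)]`. -/
def conj (h : IsNuPair l r ρ) (z : L) (t : ↥⁅l.range, r.range⁆) : ↥⁅l.range, r.range⁆ :=
  ⟨z * t * z⁻¹, h.commutator_normal.conj_mem t t.2 z⟩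

theorem conj_twist_left (h : IsNuPair l r ρ) (g : G) (t : ↥⁅l.range, r.range⁆) :
    l g * h.twist t * (l g)⁻¹ = h.twist (h.conj (l g) t) := by
  simp only [twist_apply, conj, map_mul, map_inv, h.retract_left]
  group

theorem conj_twist_right (h : IsNuPair l r ρ) (g : G) (t : ↥⁅l.range, r.range⁆) :
    r g * h.twist t * (r g)⁻¹ = h.twist t := by
  rw [← (h.twist_commute_right t g).eq, mul_inv_cancel_right]

/-- The homomorphism `t ↦ t⁻¹ ρ(t)^φ` from `[l(G), r(G)]` to `L`. -/
def twist' (h : IsNuPair l r ρ) : ↥⁅l.range, r.range⁆ →* L :=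
  h.symm.twist.comp (Subgroup.inclusion (Subgroup.commutator_comm _ _).le)

theorem twist'_commute_of_mem (h : IsNuPair l r ρ) (t : ↥⁅l.range, r.range⁆) {s : L}
    (hs : s ∈ ⁅l.range, r.range⁆) : Commute (h.twist' t) s :=
  h.symm.twist_commute_of_mem _ (by rwa [Subgroup.commutator_comm])

theorem conj_twist'_left (h : IsNuPair l r ρ) (g : G) (t : ↥⁅l.range, r.range⁆) :
    l g * h.twist' t * (l g)⁻¹ = h.twist' t :=
  h.symm.conj_twist_right g _

theorem conj_twist'_right (h : IsNuPair l r ρ) (g : G) (t : ↥⁅l.range, r.range⁆) :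
    r g * h.twist' t * (r g)⁻¹ = h.twist' (h.conj (r g) t) :=
  h.symm.conj_twist_left g _

theorem twist_commute_twist' (h : IsNuPair l r ρ) (t s : ↥⁅l.range, r.range⁆) :
    Commute (h.twist t) (h.twist' s) :=
  (h.twist_commute_of_mem t (inv_mem s.2)).mul_right (h.twist_commute_right t _)

/-- The homomorphism `(a, b, c) ↦ a · twist b · twist' c`. -/
def tripleHom (h : IsNuPair l r ρ) :
    ↥⁅l.range, r.range⁆ × ↥⁅l.range, r.range⁆ × ↥⁅l.range, r.range⁆ →* L :=
  (Subgroup.subtype _).noncommCoprod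
    (h.twist.noncommCoprod h.twist' h.twist_commute_twist')
    fun a b => Commute.mul_right (h.twist_commute_of_mem b.1 a.2).symm
      (h.twist'_commute_of_mem b.2 a.2).symm

theorem tripleHom_apply (h : IsNuPair l r ρ) (a b c : ↥⁅l.range, r.range⁆) :
    h.tripleHom (a, b, c) = a * (h.twist b * h.twist' c) := rfl

theorem conj_tripleHom_left (h : IsNuPair l r ρ) (g : G) (a b c : ↥⁅l.range, r.range⁆) :
    l g * h.tripleHom (a, b, c) * (l g)⁻¹ =
      h.tripleHom (h.conj (l g) a, h.conj (l g) b, c) := by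
  calc
    _ = l g * a * (l g)⁻¹ * (l g * h.twist b * (l g)⁻¹ * (l g * h.twist' c * (l g)⁻¹)) := by
      rw [tripleHom_apply]; group
    _ = _ := by rw [conj_twist_left, conj_twist'_left]; rfl

theorem conj_tripleHom_right (h : IsNuPair l r ρ) (g : G) (a b c : ↥⁅l.range, r.range⁆) :
    r g * h.tripleHom (a, b, c) * (r g)⁻¹ =
      h.tripleHom (h.conj (r g) a, b, h.conj (r g) c) := by
  calc
    _ = r g * a * (r g)⁻¹ * (r g * h.twist b * (r g)⁻¹ * (r g * h.twist' c * (r g)⁻¹)) := by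
      rw [tripleHom_apply]; group
    _ = _ := by rw [conj_twist_right, conj_twist'_right]; rfl

/-! ### Images of cubes and their commutators -/

/-- The image of `K × K × K` under `tripleHom`. -/
def triple (h : IsNuPair l r ρ) (K : Subgroup ↥⁅l.range, r.range⁆) : Subgroup L :=
  (K.prod (K.prod K)).map h.tripleHom

theorem tripleHom_mem_triple (h : IsNuPair l r ρ) {K : Subgroup ↥⁅l.range, r.range⁆}
    {a b c : ↥⁅l.range, r.range⁆} (ha : a ∈ K) (hb : b ∈ K) (hc : c ∈ K) :
    h.tripleHom (a, b, c) ∈ h.triple K :=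
  Subgroup.mem_map_of_mem _ ⟨ha, hb, hc⟩

theorem exists_of_mem_triple (h : IsNuPair l r ρ) {K : Subgroup ↥⁅l.range, r.range⁆} {x : L}
    (hx : x ∈ h.triple K) : ∃ a ∈ K, ∃ b ∈ K, ∃ c ∈ K, h.tripleHom (a, b, c) = x := by
  obtain ⟨⟨a, b, c⟩, ⟨ha, hb, hc⟩, rfl⟩ := hx
  exact ⟨a, ha, b, hb, c, hc, rfl⟩

theorem triple_normal (h : IsNuPair l r ρ) {K : Subgroup ↥⁅l.range, r.range⁆}
    (hK : ∀ z, ∀ t ∈ K, h.conj z t ∈ K) : (h.triple K).Normal := by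
  refine ⟨fun x hx z => ?_⟩
  induction z using h.induction with
  | one => simpa using hx
  | left g z ih =>
    rw [mul_inv_rev, show l g * z * x * (z⁻¹ * (l g)⁻¹) = l g * (z * x * z⁻¹) * (l g)⁻¹ by group]
    obtain ⟨a, ha, b, hb, c, hc, h1⟩ := h.exists_of_mem_triple ih
    rw [← h1, conj_tripleHom_left]
    exact h.tripleHom_mem_triple (hK _ a ha) (hK _ b hb) hc
  | right g z ih =>
    rw [mul_inv_rev, show r g * z * x * (z⁻¹ * (r g)⁻¹) = r g * (z * x * z⁻¹) * (r g)⁻¹ by group]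
    obtain ⟨a, ha, b, hb, c, hc, h1⟩ := h.exists_of_mem_triple ih
    rw [← h1, conj_tripleHom_right]
    exact h.tripleHom_mem_triple (hK _ a ha) hb (hK _ c hc)

theorem commutator_triple (h : IsNuPair l r ρ) (K : Subgroup ↥⁅l.range, r.range⁆) :
    ⁅h.triple K, h.triple K⁆ = h.triple ⁅K, K⁆ := by
  simp only [triple, ← Subgroup.map_commutator, Subgroup.commutator_prod_prod]

/-- Conjugation by g moves only the first two coordinates and conjugation by g^φ only the first and
third. Both act on a moved coordinate in the same way, so the commutator is computed coordinatewise
and one hypothesis serves both copies. -/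
theorem commutator_triple_top_le (h : IsNuPair l r ρ) {K K' : Subgroup ↥⁅l.range, r.range⁆}
    (hK' : ∀ z, ∀ t ∈ K', h.conj z t ∈ K')
    (hK : ∀ g, ∀ t ∈ K, t * (h.conj (l g) t)⁻¹ ∈ K') : ⁅h.triple K, ⊤⁆ ≤ h.triple K' := by
  have := h.triple_normal hK'
  rw [← h.range_sup_range]
  apply Subgroup.commutator_sup_le_of_normal <;> rw [Subgroup.commutator_le]
  · rintro x hx _ ⟨g, rfl⟩
    obtain ⟨a, ha, b, hb, c, hc, rfl⟩ := h.exists_of_mem_triple hx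
    rw [commutatorElement_def, mul_assoc, mul_assoc, ← mul_assoc (l g), ← conj_inv,
      conj_tripleHom_left, ← map_inv, ← map_mul]
    exact h.tripleHom_mem_triple (hK g a ha) (hK g b hb)
      ((mul_inv_cancel c).symm ▸ one_mem K')
  · rintro x hx _ ⟨g, rfl⟩
    obtain ⟨a, ha, b, hb, c, hc, rfl⟩ := h.exists_of_mem_triple hx
    have hconj (t) : h.conj (r g) t = h.conj (l g) t :=
      Subtype.ext (h.conj_left_eq_conj_right g t.2).symm
    rw [commutatorElement_def, mul_assoc, mul_assoc, ← mul_assoc (r g), ← conj_inv,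
      conj_tripleHom_right, hconj, hconj, ← map_inv, ← map_mul]
    exact h.tripleHom_mem_triple (hK g a ha) ((mul_inv_cancel b).symm ▸ one_mem K')
      (hK g c hc)

/-- With t = [a, b^φ], the triples (t, t, 1) and (t, 1, t) map to [a, b] and [a, b]^φ, since t
cancels against the t⁻¹ in the twist. -/
theorem commutator_le_triple (h : IsNuPair l r ρ) : ⁅(⊤ : Subgroup L), ⊤⁆ ≤ h.triple ⊤ := by
  have := h.triple_normal (K := ⊤) fun _ _ _ => trivial
  have hY : ⁅l.range, r.range⁆ ≤ h.triple ⊤ := fun t ht => by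
    simpa [tripleHom_apply] using
      h.tripleHom_mem_triple (Subgroup.mem_top ⟨t, ht⟩) (Subgroup.mem_top 1) (Subgroup.mem_top 1)
  have hl : ⁅l.range, l.range⁆ ≤ h.triple ⊤ := by
    rw [Subgroup.commutator_le]
    rintro _ ⟨a, rfl⟩ _ ⟨b, rfl⟩
    have ht := Subgroup.commutator_mem_commutator (H₁ := l.range) (H₂ := r.range)
      ⟨a, rfl⟩ ⟨b, rfl⟩
    simpa [tripleHom_apply, twist_apply, map_commutatorElement, h.retract_left,
      h.retract_right, -commutatorElement_inv] using h.tripleHom_mem_triple (Subgroup.mem_top ⟨_, ht⟩)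
        (Subgroup.mem_top ⟨_, ht⟩) (Subgroup.mem_top 1)
  have hr : ⁅r.range, r.range⁆ ≤ h.triple ⊤ := by
    rw [Subgroup.commutator_le]
    rintro _ ⟨a, rfl⟩ _ ⟨b, rfl⟩
    have ht := Subgroup.commutator_mem_commutator (H₁ := l.range) (H₂ := r.range)
      ⟨a, rfl⟩ ⟨b, rfl⟩
    simpa [tripleHom_apply, twist', twist_apply, map_commutatorElement, h.retract_left,
      h.retract_right, -commutatorElement_inv] using h.tripleHom_mem_triple (Subgroup.mem_top ⟨_, ht⟩)
        (Subgroup.mem_top 1) (Subgroup.mem_top ⟨_, ht⟩)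
  rw [← h.range_sup_range]
  apply Subgroup.commutator_sup_le_of_normal <;> rw [Subgroup.commutator_comm] <;>
    apply Subgroup.commutator_sup_le_of_normal
  · exact hl
  · exact (Subgroup.commutator_comm_le _ _).trans (by rwa [Subgroup.commutator_comm])
  · rwa [Subgroup.commutator_comm]
  · exact hr

theorem exponent_triple_dvd (h : IsNuPair l r ρ) (K : Subgroup ↥⁅l.range, r.range⁆) :
    Monoid.exponent (h.triple K) ∣ Monoid.exponent K := by
  rw [Monoid.exponent_dvd_iff_forall_pow_eq_one]
  rintro ⟨x, hx⟩
  obtain ⟨a, ha, b, hb, c, hc, rfl⟩ := h.exists_of_mem_triple hx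
  have hpow {t : ↥⁅l.range, r.range⁆} (ht : t ∈ K) : t ^ Monoid.exponent K = 1 :=
    congrArg Subtype.val (Monoid.pow_exponent_eq_one (⟨t, ht⟩ : K))
  apply Subtype.ext
  simp only [SubmonoidClass.mk_pow, ← map_pow, Prod.pow_mk, hpow ha, hpow hb, hpow hc]
  exact map_one h.tripleHom

end IsNuPair

theorem exponent_dvd_of_le {L : Type*} [Group L] {H K : Subgroup L} (hHK : H ≤ K) :
    Monoid.exponent H ∣ Monoid.exponent K :=
  Monoid.exponent_dvd_of_monoidHom (Subgroup.inclusion hHK) (Subgroup.inclusion_injective hHK)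

/-! ### Exponents in ν(G) -/

section Nu

variable (G : Type*) [Group G]

theorem conj_comm_left (a b c : G) : conjBy (comm (left G a) (right G b)) (left G c) =
    comm (left G (conjBy a c)) (right G (conjBy b c)) := by
  have h1 : QuotientGroup.mk' (Subgroup.normalClosure (relators G)) _ = 1 :=
    (QuotientGroup.eq_one_iff _).2 (Subgroup.subset_normalClosure ⟨a, b, c, Or.inl rfl⟩)
  rw [map_mul, map_inv] at h1
  exact mul_inv_eq_one.1 h1

theorem conj_comm_right (a b c : G) : conjBy (comm (left G a) (right G b)) (right G c) =
    comm (left G (conjBy a c)) (right G (conjBy b c)) := by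
  have h1 : QuotientGroup.mk' (Subgroup.normalClosure (relators G)) _ = 1 :=
    (QuotientGroup.eq_one_iff _).2 (Subgroup.subset_normalClosure ⟨a, b, c, Or.inr rfl⟩)
  rw [map_mul, map_inv] at h1
  exact mul_inv_eq_one.1 h1

/-- The homomorphism `ν(G) → G` with `g ↦ g` and `g^φ ↦ g`. -/
def retraction : Nu G →* G :=
  QuotientGroup.lift (Subgroup.normalClosure (relators G))
    (Monoid.Coprod.lift (MonoidHom.id G) (MonoidHom.id G)) (by
      refine Subgroup.normalClosure_le_normal (N := MonoidHom.ker _) ?_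
      rintro _ ⟨a, b, c, rfl | rfl⟩ <;>
        simp [MonoidHom.mem_ker, conjBy, comm, freeLeft, freeRight] <;> group)

theorem isNuPair : IsNuPair (left G) (right G) (retraction G) where
  retract_left _ := rfl
  retract_right _ := rfl
  range_sup_range := by
    change ((QuotientGroup.mk' (Subgroup.normalClosure (relators G))).comp (freeLeft G)).range ⊔
      ((QuotientGroup.mk' (Subgroup.normalClosure (relators G))).comp (freeRight G)).range =
      (⊤ : Subgroup (_ ⧸ _))
    rw [MonoidHom.range_comp, MonoidHom.range_comp, ← Subgroup.map_sup, freeLeft,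
      freeRight, Monoid.Coprod.range_inl_sup_range_inr, ← MonoidHom.range_eq_map,
      MonoidHom.range_eq_top]
    exact QuotientGroup.mk'_surjective _
  conj_left a b c := by
    -- Inverting all three arguments passes from x⁻¹y⁻¹xy and y⁻¹xy to the conventions xyx⁻¹y⁻¹ and
    -- yxy⁻¹.
    simpa [conjBy, comm, commutatorElement_def, mul_assoc] using conj_comm_left G a⁻¹ b⁻¹ c⁻¹
  conj_right a b c := by
    simpa [conjBy, comm, commutatorElement_def, mul_assoc] using conj_comm_right G a⁻¹ b⁻¹ c⁻¹

theorem map_derivedSeries_Upsilon₁_le (k : ℕ) :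
    (derivedSeries (Upsilon₁ G) k).map (Upsilon₁ G).subtype ≤ derivedSeries (Nu G) (k + 1) := by
  induction k with
  | zero =>
    rw [derivedSeries_zero, ← MonoidHom.range_eq_map, Subgroup.range_subtype]
    exact Subgroup.commutator_mono le_top le_top
  | succ k ih =>
    rw [derivedSeries_succ, Subgroup.map_commutator, derivedSeries_succ (Nu G) (k + 1)]
    exact Subgroup.commutator_mono ih ih

theorem derivedSeries_le_triple (k : ℕ) :
    derivedSeries (Nu G) (k + 1) ≤ (isNuPair G).triple (derivedSeries (Upsilon₁ G) k) := by
  induction k with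
  | zero => exact (isNuPair G).commutator_le_triple
  | succ k ih =>
    exact (Subgroup.commutator_mono ih ih).trans ((isNuPair G).commutator_triple _).le

theorem exponent_derivedSeries (k : ℕ) : Monoid.exponent (derivedSeries (Nu G) (k + 1)) =
    Monoid.exponent (derivedSeries (Upsilon₁ G) k) := by
  apply Nat.dvd_antisymm
  · exact (exponent_dvd_of_le (derivedSeries_le_triple G k)).trans
      ((isNuPair G).exponent_triple_dvd _)
  · rw [Monoid.exponent_eq_of_mulEquiv ((derivedSeries (Upsilon₁ G) k).equivMapOfInjective _
      (Upsilon₁ G).subtype_injective)]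
    exact exponent_dvd_of_le (map_derivedSeries_Upsilon₁_le G k)

theorem iterComm_le_Upsilon₁ (n : ℕ) : iterComm (Upsilon₁ G) (left G).range n ≤ Upsilon₁ G := by
  have : (Upsilon₁ G).Normal := (isNuPair G).commutator_normal
  induction n with
  | zero => exact le_rfl
  | succ n ih =>
    exact (Subgroup.commutator_mono ih le_top).trans (Subgroup.commutator_le_left (Upsilon₁ G) ⊤)

/-- Commutation with G and with G^φ gives the same subgroup, because both copies act alike on Υ₁. So
each copy normalizes it. -/
theorem iterComm_normal (n : ℕ) : (iterComm (Upsilon₁ G) (left G).range n).Normal := by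
  induction n with
  | zero => exact (isNuPair G).commutator_normal
  | succ n ih =>
    have h1 : ⁅iterComm (Upsilon₁ G) (left G).range n, (left G).range⁆ =
        ⁅iterComm (Upsilon₁ G) (left G).range n, (right G).range⁆ := by
      apply le_antisymm <;> rw [Subgroup.commutator_le] <;> rintro s hs _ ⟨g, rfl⟩
      all_goals
        have h2 := (isNuPair G).conj_left_eq_conj_right g
          (inv_mem (iterComm_le_Upsilon₁ G n hs))
        have h3 : ⁅s, left G g⁆ = ⁅s, right G g⁆ := by
          simpa only [commutatorElement_def, mul_assoc] using congrArg (s * ·) h2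
      · exact h3 ▸ Subgroup.commutator_mem_commutator hs ⟨g, rfl⟩
      · exact h3 ▸ Subgroup.commutator_mem_commutator hs ⟨g, rfl⟩
    rw [iterComm, ← Subgroup.normalizer_eq_top_iff, eq_top_iff, ← (isNuPair G).range_sup_range]
    refine sup_le (Subgroup.normalizer_commutator_ge_right _ _) ?_
    rw [h1]
    exact Subgroup.normalizer_commutator_ge_right _ _

theorem iterComm_le_lowerCentralSeries (n : ℕ) : iterComm (Upsilon₁ G) (left G).range n ≤
    (⊤ : Subgroup (Nu G)).lowerCentralSeries (n + 1) := by
  induction n with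
  | zero => exact Subgroup.commutator_mono le_top le_top
  | succ n ih => exact Subgroup.commutator_mono ih le_top

theorem lowerCentralSeries_le_triple (n : ℕ) :
    (⊤ : Subgroup (Nu G)).lowerCentralSeries (n + 1) ≤
      (isNuPair G).triple ((iterComm (Upsilon₁ G) (left G).range n).subgroupOf (Upsilon₁ G)) := by
  induction n with
  | zero =>
    refine (isNuPair G).commutator_le_triple.trans ?_
    rw [iterComm, Subgroup.subgroupOf_self]
    exact le_rfl
  | succ n ih =>
    refine (Subgroup.commutator_mono ih le_rfl).trans
      ((isNuPair G).commutator_triple_top_le ?_ ?_)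
    · exact fun z t ht => (iterComm_normal G (n + 1)).conj_mem _ ht z
    · intro g t ht
      have h1 := Subgroup.commutator_mem_commutator (H₂ := (left G).range) ht ⟨g, rfl⟩
      change (t : Nu G) * (left G g * (t : Nu G) * (left G g)⁻¹)⁻¹ ∈
        ⁅iterComm (Upsilon₁ G) (left G).range n, (left G).range⁆
      convert h1 using 1
      simp [commutatorElement_def, mul_assoc]

theorem exponent_lowerCentralSeries (n : ℕ) :
    Monoid.exponent ((⊤ : Subgroup (Nu G)).lowerCentralSeries (n + 1)) =
      Monoid.exponent (iterComm (Upsilon₁ G) (left G).range n) := by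
  apply Nat.dvd_antisymm
  · refine (exponent_dvd_of_le (lowerCentralSeries_le_triple G n)).trans ?_
    rw [← Monoid.exponent_eq_of_mulEquiv (Subgroup.subgroupOfEquivOfLe (iterComm_le_Upsilon₁ G n))]
    exact (isNuPair G).exponent_triple_dvd _
  · exact exponent_dvd_of_le (iterComm_le_lowerCentralSeries G n)

end Nu

end NuGroup

theorem mainTheorem10 (p : ℕ) (hp : p.Prime) (G : Type*) [Group G] [Finite G]
    (hG : IsPGroup p G) :
    (∀ k : ℕ,
      Monoid.exponent (derivedSeries (NuGroup.Nu G) (k + 1)) =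
        Monoid.exponent (derivedSeries (NuGroup.Upsilon₁ G) k)) ∧
    (∀ r : ℕ, 2 ≤ r →
      Monoid.exponent (NuGroup.gamma (NuGroup.Nu G) r) =
        Monoid.exponent (NuGroup.A G (r - 1))) := by
  refine ⟨NuGroup.exponent_derivedSeries G, fun r hr => ?_⟩
  -- With r = n + 2, γ_r is term n + 1 of the zero-based lower central series and A_{r-1} is the
  -- n-fold commutator.
  obtain ⟨n, rfl⟩ := Nat.exists_eq_add_of_le' hr
  exact NuGroup.exponent_lowerCentralSeries G n
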